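/- For $n\ge 0$ let $p(n)$ be the number of partitions of $n$, let $F_k(n)$ be the total number of occurrences of the part $k$ across all partitions of $n$, and let $$M_{11}(n)=\sum_{k\ge1}k^{11}F_k(n).$$ Let $\tau$ be Ramanujan's tau function, defined by $$\Delta=\eta^{24}=q\prod_{r\ge1}(1-q^r)^{24}=\sum_{n\ge1}\tau(n)q^n .$$ Then, for all $n\ge0$, $$M_{11}(n)\equiv\sum_{d=1}^{n}\tau(d)\,p(n-d)\pmod{691}.$$ -/

import Mathlib

namespace PartitionMoments

/-- The partition function `p(n)`: the number of partitions of `n`. -/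
def numPartitions (n : ℕ) : ℕ := Fintype.card (Nat.Partition n)

/-- The frequency `F_k(n)`: the total number of occurrences of the part `k` across all
partitions of `n`. -/
def frequency (k n : ℕ) : ℕ := ∑ π : Nat.Partition n, π.parts.count k

/-- A part exceeding `n` never occurs in a partition of `n`. -/
theorem frequency_eq_zero_of_lt {k n : ℕ} (h : n < k) : frequency k n = 0 := by
  refine Finset.sum_eq_zero fun π _ => Multiset.count_eq_zero.2 fun hk => ?_
  exact absurd (Nat.Partition.le_of_mem_parts hk) (not_le.2 h)

/-- The frequency moment `M_m(n) = ∑_{k ≥ 1} k ^ m * F_k(n)`. The sum stops at `k = n`, because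
`F_k(n) = 0` for `k > n` by `frequency_eq_zero_of_lt`. -/
def moment (m n : ℕ) : ℕ := ∑ k ∈ Finset.Icc 1 n, k ^ m * frequency k n

open scoped PowerSeries.WithPiTopology in
/-- The `q`-expansion `q * ∏_{r ≥ 1} (1 - q ^ r) ^ 24` of the modular discriminant `Δ = η ^ 24`,
as a formal power series over `ℤ`. The infinite product converges coefficientwise
(`multipliable_one_sub_X_pow` below). -/
noncomputable def discriminantSeries : PowerSeries ℤ :=
  PowerSeries.X * (∏' i : ℕ, (1 - (PowerSeries.X : PowerSeries ℤ) ^ (i + 1))) ^ 24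

open scoped PowerSeries.WithPiTopology in
/-- The infinite product in `discriminantSeries` converges. -/
theorem multipliable_one_sub_X_pow :
    Multipliable fun i : ℕ => 1 - (PowerSeries.X : PowerSeries ℤ) ^ (i + 1) :=
  PowerSeries.WithPiTopology.multipliable_one_sub_X_pow ℤ

/-- Ramanujan's tau function: `Δ = ∑_{n ≥ 1} τ(n) q ^ n`. -/
noncomputable def ramanujanTau (n : ℕ) : ℤ := PowerSeries.coeff n discriminantSeries

end PartitionMoments

namespace PartitionMoments

/-! Removing copies of a part `k` one at a time expresses its frequency through `p`, and summing
over `k` gives `M_m(n) = ∑ σ_m(d) p(n - d)` (`moment_eq_sum_sigma`). The claim then follows termwise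
from Ramanujan's `σ₁₁ ≡ τ` mod 691. For that, `E₁₂ - E₄³` is a cusp form of weight 12, hence a
multiple of `Δ`; since 691 divides the numerator of `B₁₂`, clearing denominators leaves the
congruence (`sigma_eleven_eq`). `coeff_qExpansion_discriminant` matches the analytic `Δ` with the
formal product. -/

-- Deleting one `k` is a bijection from partitions of `n` containing `k` to partitions of `n - k`.
open Finset in
theorem frequency_eq_add {k n : ℕ} (hk : 1 ≤ k) (hkn : k ≤ n) :
    frequency k n = numPartitions (n - k) + frequency k (n - k) := by
  have hsplit : frequency k n = ∑ π : {π : n.Partition // k ∈ π.parts}, π.1.parts.count k := by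
    rw [← Finset.sum_subtype (univ.filter fun π : n.Partition => k ∈ π.parts) (by simp)
      fun π => π.parts.count k, Finset.sum_filter_of_ne, frequency]
    exact fun π _ h => Multiset.count_ne_zero.1 h
  have hcard : ∑ π : {π : n.Partition // k ∈ π.parts}, π.1.parts.count k =
      ∑ π : (n - k).Partition, (π.parts.count k + 1) := by
    rw [← (Nat.Partition.partitionWithPartEquiv hk hkn).symm.sum_comp]
    simp
  rw [hsplit, hcard, Finset.sum_add_distrib, frequency, numPartitions, add_comm,
    Finset.sum_const, Finset.card_univ, smul_eq_mul, mul_one]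

theorem frequency_eq_sum {k : ℕ} (hk : 1 ≤ k) (n : ℕ) :
    frequency k n = ∑ d ∈ Finset.Ioc 0 n, if k ∣ d then numPartitions (n - d) else 0 := by
  induction n using Nat.strong_induction_on with
  | h n ih =>
    rcases lt_or_ge n k with hnk | hkn
    · rw [frequency_eq_zero_of_lt hnk, eq_comm]
      refine Finset.sum_eq_zero fun d hd => if_neg fun hdvd => ?_
      rw [Finset.mem_Ioc] at hd
      have := Nat.le_of_dvd hd.1 hdvd
      omega
    · rw [frequency_eq_add hk hkn, ih (n - k) (by omega),
        -- Only `d = k` contributes for `d ≤ k`; the remaining terms are the sum for `n - k`,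
        -- shifted by `k`.
        ← Finset.sum_Ioc_consecutive _ (Nat.zero_le k) hkn]
      congr 1
      · rw [Finset.sum_eq_single_of_mem k (by simp; omega)]
        · simp
        · intro d hd hdk
          rw [Finset.mem_Ioc] at hd
          refine if_neg fun hdvd => ?_
          have := Nat.le_of_dvd hd.1 hdvd
          omega
      · refine Finset.sum_bij (fun d _ => d + k) ?_ ?_ ?_ ?_
        · intro d hd
          rw [Finset.mem_Ioc] at hd ⊢
          omega
        · intro a _ b _ h
          simpa using h
        · intro d hd
          rw [Finset.mem_Ioc] at hd
          exact ⟨d - k, by rw [Finset.mem_Ioc]; omega, by omega⟩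
        · intro d _
          simp [Nat.sub_sub, add_comm]

open ArithmeticFunction.sigma in
theorem moment_eq_sum_sigma (m n : ℕ) :
    moment m n = ∑ d ∈ Finset.Icc 1 n, σ m d * numPartitions (n - d) := by
  have hfreq : moment m n = ∑ k ∈ Finset.Icc 1 n, ∑ d ∈ Finset.Icc 1 n,
      if k ∣ d then k ^ m * numPartitions (n - d) else 0 := by
    refine Finset.sum_congr rfl fun k hk => ?_
    rw [frequency_eq_sum (Finset.mem_Icc.1 hk).1, Finset.mul_sum]
    exact Finset.sum_congr rfl fun d _ => by split_ifs <;> simp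
  rw [hfreq, Finset.sum_comm]
  refine Finset.sum_congr rfl fun d hd => ?_
  rw [Finset.mem_Icc] at hd
  rw [ArithmeticFunction.sigma_apply, Finset.sum_mul, ← Finset.sum_filter]
  refine Finset.sum_congr ?_ fun _ _ => rfl
  ext k
  simp only [Finset.mem_filter, Finset.mem_Icc, Nat.mem_divisors]
  constructor
  · rintro ⟨_, h⟩
    exact ⟨h, by omega⟩
  · rintro ⟨h, h0⟩
    have := Nat.le_of_dvd (by omega) h
    have := Nat.pos_of_dvd_of_pos h (by omega)
    exact ⟨by omega, h⟩

theorem iteratedDeriv_polynomial_eval (p : Polynomial ℂ) (m : ℕ) :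
    iteratedDeriv m (fun z => p.eval z) = fun z => (Polynomial.derivative^[m] p).eval z := by
  induction m with
  | zero => simp
  | succ m ih =>
    rw [iteratedDeriv_succ, ih, Function.iterate_succ_apply']
    ext z
    exact Polynomial.deriv _

theorem iteratedDeriv_polynomial_eval_zero (p : Polynomial ℂ) (m : ℕ) :
    iteratedDeriv m (fun z => p.eval z) 0 = m.factorial * p.coeff m := by
  simp only [iteratedDeriv_polynomial_eval]
  rw [← Polynomial.coeff_zero_eq_eval_zero,
    Polynomial.coeff_iterate_derivative]
  simp [Nat.descFactorial_self]

theorem tendstoLocallyUniformlyOn_iteratedDeriv {ι : Type*} {φ : Filter ι} {F : ι → ℂ → ℂ}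
    {f : ℂ → ℂ} {U : Set ℂ} (hf : TendstoLocallyUniformlyOn F f φ U)
    (hF : ∀ i, DifferentiableOn ℂ (F i) U) (hU : IsOpen U) (m : ℕ) :
    TendstoLocallyUniformlyOn (fun i => iteratedDeriv m (F i)) (iteratedDeriv m f) φ U := by
  have hdiff : ∀ m i, DifferentiableOn ℂ (iteratedDeriv m (F i)) U := by
    intro m i
    induction m with
    | zero => simpa using hF i
    | succ m ih => rw [iteratedDeriv_succ]; exact ih.deriv hU
  induction m with
  | zero => simpa using hf
  | succ m ih =>
    simp only [iteratedDeriv_succ]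
    exact ih.deriv (Filter.Eventually.of_forall (hdiff m)) hU

theorem tendstoLocallyUniformlyOn_pow {ι : Type*} {φ : Filter ι} {F : ι → ℂ → ℂ}
    {f : ℂ → ℂ} {U : Set ℂ} (hf : TendstoLocallyUniformlyOn F f φ U) (hc : ContinuousOn f U)
    (k : ℕ) : TendstoLocallyUniformlyOn (fun i => F i ^ k) (f ^ k) φ U := by
  induction k with
  | zero =>
    simp only [pow_zero]
    exact fun u hu x hx => ⟨U, self_mem_nhdsWithin, by
      filter_upwards with i y _ using refl_mem_uniformity hu⟩
  | succ k ih =>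
    simp only [pow_succ]
    exact ih.mul₀ hf (hc.pow k) hc

/-- The product `X * ∏ (1 - X ^ (i + 1)) ^ 24` over a finite set of indices `i`. -/
noncomputable def discriminantPartialProduct (s : Finset ℕ) : Polynomial ℤ :=
  Polynomial.X * (∏ i ∈ s, (1 - Polynomial.X ^ (i + 1))) ^ 24

/-- Coefficientwise convergence in the discrete space `ℤ` means each coefficient is eventually
constant. -/
theorem eventually_coeff_discriminantPartialProduct (m : ℕ) :
    ∀ᶠ s in Filter.atTop, (discriminantPartialProduct s).coeff m = ramanujanTau m := by
  open scoped PowerSeries.WithPiTopology in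
  have h := multipliable_one_sub_X_pow.hasProd
  rw [HasProd] at h
  have h2 := (h.pow 24).const_mul (PowerSeries.X : PowerSeries ℤ)
  have h3 := (PowerSeries.WithPiTopology.tendsto_iff_coeff_tendsto ..).1 h2 m
  rw [nhds_discrete, Filter.tendsto_pure] at h3
  filter_upwards [h3] with s hs
  rw [ramanujanTau, discriminantSeries]
  rw [← hs, discriminantPartialProduct, ← Polynomial.coeff_coe]
  have hcoe : ((∏ i ∈ s, (1 - Polynomial.X ^ (i + 1)) : Polynomial ℤ) : PowerSeries ℤ) =
      ∏ i ∈ s, (1 - PowerSeries.X ^ (i + 1)) := by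
    rw [← Polynomial.coeToPowerSeries.ringHom_apply, map_prod]
    simp
  simp [hcoe]

-- Locally uniform convergence on the unit disc carries over to derivatives at 0, where those of the
-- partial products are eventually `m! τ(m)`.
open ModularForm UpperHalfPlane in
theorem coeff_qExpansion_discriminant (m : ℕ) :
    (qExpansion 1 ModularForm.discriminant).coeff m = ramanujanTau m := by
  set U := Metric.ball (0 : ℂ) 1
  have hprod : TendstoLocallyUniformlyOn (fun (s : Finset ℕ) (q : ℂ) => ∏ i ∈ s, (1 - q ^ (i + 1)))
      (fun q => ∏' i, (1 - q ^ (i + 1))) Filter.atTop U :=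
    multipliableLocallyUniformlyOn_one_sub_pow.hasProdLocallyUniformlyOn
  have hcont := differentiableOn_tprod_one_sub_pow.continuousOn
  have hid : TendstoLocallyUniformlyOn (fun (_ : Finset ℕ) (q : ℂ) => q) (fun q => q)
      Filter.atTop U := fun u hu x _ => ⟨U, self_mem_nhdsWithin, by
        filter_upwards with i y _ using refl_mem_uniformity hu⟩
  have hlim : TendstoLocallyUniformlyOn
      (fun s q => ((discriminantPartialProduct s).map (Int.castRingHom ℂ)).eval q)
      (cuspFunction 1 ModularForm.discriminant) Filter.atTop U := by
    refine ((hid.mul₀ (tendstoLocallyUniformlyOn_pow hprod hcont 24) continuousOn_id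
      (hcont.pow 24)).congr ?_).congr_right ?_
    · intro s q _
      simp [discriminantPartialProduct, Polynomial.map_prod, Polynomial.eval_prod]
    · intro q hq
      rw [discriminant_cuspFunction_eqOn hq]
      simp only [Pi.mul_apply, Pi.pow_apply]
      rw [(multipliable_one_sub_pow (by simpa [U] using hq)).tprod_pow]
  have hderiv := (tendstoLocallyUniformlyOn_iteratedDeriv hlim
    (fun s => (Polynomial.differentiable _).differentiableOn) Metric.isOpen_ball m).tendsto_at
      (Metric.mem_ball_self one_pos)
  have hconst : Filter.Tendsto (fun s => iteratedDeriv m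
      (fun q => ((discriminantPartialProduct s).map (Int.castRingHom ℂ)).eval q) 0)
      Filter.atTop (nhds (m.factorial * (ramanujanTau m : ℂ))) := by
    refine tendsto_const_nhds.congr' ?_
    filter_upwards [eventually_coeff_discriminantPartialProduct m] with s hs
    rw [iteratedDeriv_polynomial_eval_zero, Polynomial.coeff_map, hs, eq_intCast]
  rw [qExpansion_coeff, tendsto_nhds_unique hderiv hconst,
    inv_mul_cancel_left₀ (by exact_mod_cast m.factorial_ne_zero)]

open ModularForm UpperHalfPlane EisensteinSeries ArithmeticFunction.sigma MatrixGroups in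
theorem exists_smul_qExpansion_E₁₂_sub_E₄_pow :
    ∃ c : ℂ, qExpansion 1 (E (show 3 ≤ 12 by norm_num)) - qExpansion 1 E₄ ^ 3 =
      c • qExpansion 1 ModularForm.discriminant := by
  let f : ModularForm 𝒮ℒ 12 := E (show 3 ≤ 12 by norm_num) -
    ModularForm.mcast (by decide) (E₄.pow 3)
  have hf : qExpansion 1 f = qExpansion 1 (E (show 3 ≤ 12 by norm_num)) - qExpansion 1 E₄ ^ 3 := by
    simp only [f, FunLike.coe_sub, ModularForm.coe_mcast,
      ModularForm.qExpansion_sub one_pos one_mem_strictPeriods_SL,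
      ModularForm.qExpansion_pow one_pos one_mem_strictPeriods_SL]
  -- Both Eisenstein series have constant term 1.
  have hcusp : IsCuspForm f := by
    rw [isCuspForm_iff_coeffZero_eq_zero, hf]
    simp [PowerSeries.coeff_mul, pow_succ, -PowerSeries.coeff_zero_eq_constantCoeff,
      E_qExpansion_coeff_zero _ (show Even 4 from ⟨2, rfl⟩),
      E_qExpansion_coeff_zero _ (show Even 12 from ⟨6, rfl⟩)]
  obtain ⟨g, hg⟩ := hcusp
  obtain ⟨c, hc⟩ := CuspForm.exists_smul_discriminant_of_weight_eq_twelve g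
  have hgf : (g : ℍ → ℂ) = f := congrArg DFunLike.coe hg
  have hcg : (c • CuspForm.discriminant : ℍ → ℂ) = g := congrArg DFunLike.coe hc
  refine ⟨c, ?_⟩
  rw [← hf, ← hgf, ← hcg]
  exact ModularForm.qExpansion_smul one_pos one_mem_strictPeriods_SL c CuspForm.discriminant

open ArithmeticFunction.sigma in
/-- The integral `q`-expansion of the Eisenstein series `E₄`. -/
noncomputable def eisensteinFourSeries : PowerSeries ℤ :=
  PowerSeries.mk fun n => if n = 0 then 1 else 240 * σ 3 n

open ModularForm UpperHalfPlane EisensteinSeries in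
theorem qExpansion_E₄_eq_map :
    qExpansion 1 E₄ = eisensteinFourSeries.map (Int.castRingHom ℂ) := by
  ext m
  rw [E_qExpansion_coeff _ (show Even 4 from ⟨2, rfl⟩), PowerSeries.coeff_map,
    eisensteinFourSeries, PowerSeries.coeff_mk, show bernoulli 4 = -1 / 30 by decide +kernel]
  split_ifs
  · simp
  · norm_num

open ModularForm UpperHalfPlane EisensteinSeries ArithmeticFunction.sigma in
theorem sigma_eleven_eq {n : ℕ} (hn : n ≠ 0) :
    65520 * (σ 11 n : ℤ) - 691 * PowerSeries.coeff n (eisensteinFourSeries ^ 3) =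
      (65520 - 691 * 720) * ramanujanTau n := by
  obtain ⟨c, hc⟩ := exists_smul_qExpansion_E₁₂_sub_E₄_pow
  have hcoeff : ∀ m : ℕ, m ≠ 0 → 65520 / 691 * (σ 11 m : ℂ) -
      (PowerSeries.coeff m (eisensteinFourSeries ^ 3) : ℤ) = c * ramanujanTau m := by
    intro m hm
    have h := congrArg (PowerSeries.coeff m) hc
    rw [map_sub, E_qExpansion_coeff _ (show Even 12 from ⟨6, rfl⟩), if_neg hm,
      qExpansion_E₄_eq_map, ← map_pow, PowerSeries.coeff_map, PowerSeries.coeff_smul,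
      coeff_qExpansion_discriminant, show bernoulli 12 = -691 / 2730 by decide +kernel] at h
    norm_num at h ⊢
    exact h
  -- Compare coefficients of `q`: `E₄³` contributes `3 * 240`, and `65520 / 691 = -24 / B₁₂`.
  have hone : c = 65520 / 691 - 720 := by
    have h := hcoeff 1 one_ne_zero
    have htau : (ramanujanTau 1 : ℂ) = 1 := by
      rw [← coeff_qExpansion_discriminant, discriminant_qExpansion_coeff_one]
    have hcube : PowerSeries.coeff 1 (eisensteinFourSeries ^ 3) = 720 := by
      simp [pow_succ, PowerSeries.coeff_mul, Finset.Nat.antidiagonal_succ, eisensteinFourSeries]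
    rw [htau, hcube] at h
    simp at h
    linear_combination -h
  have h := hcoeff n hn
  rw [hone] at h
  have hz : (65520 * (σ 11 n : ℂ) - 691 * (PowerSeries.coeff n (eisensteinFourSeries ^ 3) : ℤ)) =
      (65520 - 691 * 720) * ramanujanTau n := by
    linear_combination 691 * h
  exact_mod_cast hz

open ArithmeticFunction.sigma in
/-- Ramanujan's congruence. -/
theorem sigma_eleven_modEq_ramanujanTau {n : ℕ} (hn : n ≠ 0) :
    (σ 11 n : ℤ) ≡ ramanujanTau n [ZMOD 691] := by
  have h := sigma_eleven_eq hn
  rw [Int.modEq_iff_dvd]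
  -- Modulo 691 the identity reads `65520 (σ₁₁ - τ) ≡ 0`, and 65520 is prime to 691.
  omega

end PartitionMoments

theorem mainTheorem5 (n : ℕ) :
    (PartitionMoments.moment 11 n : ℤ) ≡
      ∑ d ∈ Finset.Icc 1 n,
        PartitionMoments.ramanujanTau d * (PartitionMoments.numPartitions (n - d) : ℤ)
      [ZMOD 691] := by
  rw [PartitionMoments.moment_eq_sum_sigma]
  push_cast
  refine Int.ModEq.sum fun d hd => ?_
  exact (PartitionMoments.sigma_eleven_modEq_ramanujanTau
    (by rw [Finset.mem_Icc] at hd; omega)).mul_right _
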